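/- Let $k\ge 0$ be an integer. A homogenized spectral pencil of order $k$ is a family $$T_\lambda=\sum_{i=0}^k Q_i(z)\,\lambda^{k-i}\frac{d^i}{dz^i},\qquad Q_i(z)=\sum_{j=0}^i a_{i,j}z^j,$$ and is identified with its coefficient vector $a=(a_{i,j})_{0\le j\le i\le k}$ in the complex vector space $E_k\cong\mathbb C^{(k+1)(k+2)/2}$. It is of \emph{general type} if $a_{k,k}\ne 0$, $a_{0,0}\neq 0$, and the $k$ roots (counted with multiplicity) of the characteristic equation $a_{k,k}+a_{k-1,k-1}t+\dots+a_{0,0}t^k=0$ are distinct and no two of them lie on a common real line through the origin of $\mathbb C$. Let $\mathcal G_k\subset E_k$ be the set of pencils of general type. The branches at $p\in\mathbb C$ of the plane curve associated with $T_\lambda$ are the solutions $w$ of $\sum_{i=0}^k Q_i(p)w^i=0$. Let $\Gamma_2=\Gamma_2(T_\lambda)\subset\mathbb C$ be the set of all $p$ such that either there are not $k$ distinct finite branches over $p$ (that is, $Q_k(p)=0$ or two branches coincide at $p$), or there are at least two distinct three-element sets $\{w_1,w_2,w_3\}$ of branches at $p$ such that $w_1,w_2,w_3$ lie on a real line in $\mathbb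 C$. The real Zariski topology on $E_k$ is the one whose closed sets are the common zero sets of families of real polynomials in the real and imaginary parts of the $a_{i,j}$. \textbf{Theorem.} For a typical pencil of general type the set $\Gamma_2$ is finite. Precisely: there is a non-empty set $U\subseteq\mathcal G_k$ that is the intersection of $\mathcal G_k$ with a real-Zariski-open subset of $E_k$, is open in $E_k$ in the Euclidean topology, and is dense in $\mathcal G_k$ in both the Euclidean and the real Zariski topology, such that $\Gamma_2(T_\lambda)$ is finite for every pencil $T_\lambda\in U$. -/

import Mathlib

namespace HomogenizedPencil

/-- The index set of the coefficients `a i j`, `0 ≤ j ≤ i ≤ k`. -/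
abbrev Index (k : ℕ) : Type := Σ i : Fin (k + 1), Fin (i.1 + 1)

/-- The space of homogenized spectral pencils
`T_lam = ∑ i ≤ k, Q_i(z) lam ^ (k - i) (d/dz) ^ i` with `deg Q_i ≤ i`, given by the coefficients
`a i j` of `Q_i(z) = ∑ j ≤ i, a i j z ^ j`.  It carries the Euclidean (product) topology. -/
abbrev Pencil (k : ℕ) : Type := Index k → ℂ

variable {k : ℕ}

/-- The polynomial `Q_i(z) = ∑ j ≤ i, a i j z ^ j`. -/
noncomputable def Q (a : Pencil k) (i : Fin (k + 1)) : Polynomial ℂ :=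
  ∑ j : Fin (i.1 + 1), Polynomial.C (a ⟨i, j⟩) * Polynomial.X ^ j.1

/-- The diagonal coefficient `a i i`, that is, the coefficient of `z ^ i` in `Q_i`. -/
def diag (a : Pencil k) (i : Fin (k + 1)) : ℂ := a ⟨i, Fin.last i.1⟩

/-- The characteristic polynomial `a k k + a (k-1) (k-1) t + ⋯ + a 0 0 t ^ k`. -/
noncomputable def characteristic (a : Pencil k) : Polynomial ℂ :=
  ∑ i : Fin (k + 1), Polynomial.C (diag a i) * Polynomial.X ^ (k - i.1)

/-- General type: `deg Q_k = k`, and the characteristic polynomial has degree `k`, distinct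
roots, and no two of its roots on a common real line through the origin of `ℂ`. -/
def IsGeneralType (a : Pencil k) : Prop :=
  diag a (Fin.last k) ≠ 0 ∧ diag a 0 ≠ 0 ∧ (characteristic a).roots.Nodup ∧
    ∀ s ∈ (characteristic a).roots, ∀ t ∈ (characteristic a).roots, s ≠ t →
      ¬ Collinear ℝ ({0, s, t} : Set ℂ)

/-- The set of pencils of general type. -/
def generalType (k : ℕ) : Set (Pencil k) := {a | IsGeneralType a}

/-- The polynomial `∑ i ≤ k, Q_i(p) w ^ i` in `w`, whose roots are the values at `p` of the
branches of the associated plane curve. -/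
noncomputable def fibre (a : Pencil k) (p : ℂ) : Polynomial ℂ :=
  ∑ i : Fin (k + 1), Polynomial.C ((Q a i).eval p) * Polynomial.X ^ i.1

/-- The exceptional set: the points `p` over which the plane curve does not have `k` distinct
finite branches (a pole of a branch, `Q_k(p) = 0`, or a branch point, where two branches
coincide), together with the points `p` at which, for at least two distinct triples of branches,
the values of the three branches lie on a real line. -/
def Gamma2 (a : Pencil k) : Set ℂ :=
  {p | (Q a (Fin.last k)).eval p = 0 ∨ ¬ (fibre a p).roots.Nodup ∨
    ∃ S T : Finset ℂ, S ≠ T ∧ S.card = 3 ∧ T.card = 3 ∧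
      (∀ w ∈ S, w ∈ (fibre a p).roots) ∧ (∀ w ∈ T, w ∈ (fibre a p).roots) ∧
      Collinear ℝ (S : Set ℂ) ∧ Collinear ℝ (T : Set ℂ)}

/-- The real coordinates of a pencil: real and imaginary parts of its coefficients. -/
def realCoords (a : Pencil k) : Index k ⊕ Index k → ℝ :=
  Sum.elim (fun v => (a v).re) (fun v => (a v).im)

/-- Closed sets of the real Zariski topology on the coefficient space. -/
def IsZariskiClosed (Z : Set (Pencil k)) : Prop :=
  ∃ I : Set (MvPolynomial (Index k ⊕ Index k) ℝ),
    Z = {a | ∀ F ∈ I, MvPolynomial.eval (realCoords a) F = 0}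

/-- Open sets of the real Zariski topology on the coefficient space. -/
def IsZariskiOpen (V : Set (Pencil k)) : Prop := IsZariskiClosed Vᶜ

end HomogenizedPencil

namespace HomogenizedPencil

open Polynomial ComplexConjugate

variable {k : ℕ}

/-! The proof is a dimension count. If `f` is a real-polynomial map from the coefficient space to
itself and `h` is one more polynomial function, then `h` and the real coordinates of `f` outnumber
the variables by one, hence satisfy a nontrivial relation `G(h, f) = 0`. Wherever some coefficient
of `G`, as a polynomial in `h`, does not vanish at `a`, only finitely many values of `h` occur on `f
⁻¹' {a}` (`generic_finite_image`).

Each bad condition is parametrized by such an `f` from a space of the same dimension. The pencil is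
recovered from a point `p`, the roots over `p` and the coefficients `a i j` with `j ≠ 0`, since `a i
0` enters `Q_i(p)` with factor 1. A coincidence of two roots frees one complex parameter. Two
collinear triples free two real ones. The freed room stores `p`, so taking `h = p` leaves finitely
many `p` for generic `a`. Generality of type is itself generic: a real ratio of two characteristic
roots leaves a real parameter idle, so a nonempty fibre would carry infinitely many values of it. -/

/-! ### Polynomial functions on the coefficient space -/

/-- The complex-valued functions on the coefficient space that are polynomial in the real
coordinates. -/
noncomputable def polyFun (k : ℕ) : Subalgebra ℂ (Pencil k → ℂ) :=
  Algebra.adjoin ℂ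
    (Set.range fun (v : Index k ⊕ Index k) (θ : Pencil k) => ((realCoords θ v : ℝ) : ℂ))

theorem realCoords_mem_polyFun (v : Index k ⊕ Index k) :
    (fun θ : Pencil k => ((realCoords θ v : ℝ) : ℂ)) ∈ polyFun k :=
  Algebra.subset_adjoin ⟨v, rfl⟩

theorem const_mem_polyFun (c : ℂ) : (fun _ : Pencil k => c) ∈ polyFun k :=
  (polyFun k).algebraMap_mem c

theorem re_apply_mem_polyFun (v : Index k) : (fun θ : Pencil k => ((θ v).re : ℂ)) ∈ polyFun k :=
  realCoords_mem_polyFun (Sum.inl v)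

theorem im_apply_mem_polyFun (v : Index k) : (fun θ : Pencil k => ((θ v).im : ℂ)) ∈ polyFun k :=
  realCoords_mem_polyFun (Sum.inr v)

theorem apply_mem_polyFun (v : Index k) : (fun θ : Pencil k => θ v) ∈ polyFun k := by
  have h := (polyFun k).add_mem (re_apply_mem_polyFun v)
    ((polyFun k).mul_mem (im_apply_mem_polyFun v) (const_mem_polyFun Complex.I))
  convert h using 1
  ext θ
  simp [Complex.re_add_im]

theorem conj_mem_polyFun {f : Pencil k → ℂ} (hf : f ∈ polyFun k) :
    (fun θ => conj (f θ)) ∈ polyFun k := by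
  induction hf using Algebra.adjoin_induction with
  | mem f hf =>
    obtain ⟨v, rfl⟩ := hf
    simpa using realCoords_mem_polyFun v
  | algebraMap c => exact const_mem_polyFun (conj c)
  | add f g _ _ hf hg =>
    simp only [Pi.add_apply, map_add]
    exact (polyFun k).add_mem hf hg
  | mul f g _ _ hf hg =>
    simp only [Pi.mul_apply, map_mul]
    exact (polyFun k).mul_mem hf hg

theorem realCoords_comp_mem_polyFun {f : Pencil k → Pencil k}
    (hf : ∀ v, (fun θ => f θ v) ∈ polyFun k) (v : Index k ⊕ Index k) :
    (fun θ => ((realCoords (f θ) v : ℝ) : ℂ)) ∈ polyFun k := by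
  rcases v with v | v
  · have h := (polyFun k).mul_mem ((polyFun k).add_mem (hf v) (conj_mem_polyFun (hf v)))
      (const_mem_polyFun 2⁻¹)
    convert h using 1
    ext θ
    simp [realCoords, Complex.re_eq_add_conj, div_eq_mul_inv]
  · have h := (polyFun k).mul_mem ((polyFun k).sub_mem (hf v) (conj_mem_polyFun (hf v)))
      (const_mem_polyFun (2 * Complex.I)⁻¹)
    convert h using 1
    ext θ
    simp [realCoords, Complex.im_eq_sub_conj, div_eq_mul_inv]

/-- A polynomial ring has transcendence degree equal to its number of variables, and `Option`
supplies one function more than that. -/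
theorem exists_polynomial_relation {F : Option (Index k ⊕ Index k) → Pencil k → ℂ}
    (hF : ∀ o, F o ∈ polyFun k) :
    ∃ G : MvPolynomial (Option (Index k ⊕ Index k)) ℂ, G ≠ 0 ∧
      ∀ θ, MvPolynomial.eval (fun o => F o θ) G = 0 := by
  have hlift : ∀ o, ∃ g : MvPolynomial (Index k ⊕ Index k) ℂ,
      MvPolynomial.aeval (fun v (θ : Pencil k) => ((realCoords θ v : ℝ) : ℂ)) g = F o := by
    intro o
    have := hF o
    rwa [polyFun, Algebra.adjoin_range_eq_range_aeval] at this
  choose g hg using hlift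
  have hdep : ¬ AlgebraicIndependent ℂ g := by
    intro hind
    have h := hind.cardinalMk_le_trdeg
    rw [MvPolynomial.trdeg_of_isDomain] at h
    simp only [Cardinal.mk_fintype, Cardinal.lift_natCast, Nat.cast_le, Fintype.card_option] at h
    omega
  rw [algebraicIndependent_iff] at hdep
  push Not at hdep
  obtain ⟨G, hG, hG0⟩ := hdep
  refine ⟨G, hG0, fun θ => ?_⟩
  let e : (Pencil k → ℂ) →ₐ[ℂ] ℂ := Pi.evalAlgHom ℂ (fun _ => ℂ) θ
  have h := congrArg (fun q => e (MvPolynomial.aeval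
    (fun v (θ : Pencil k) => ((realCoords θ v : ℝ) : ℂ)) q)) hG
  simp only [map_zero] at h
  rw [← h, ← AlgHom.comp_apply, ← AlgHom.comp_apply, ← MvPolynomial.coe_aeval_eq_eval]
  change MvPolynomial.aeval _ G = _
  congr 1
  refine MvPolynomial.algHom_ext fun o => ?_
  simp [hg, e]

/-- At real points `Φ` is the real part of `conj c * g` for a nonzero coefficient `c` of `g`. The
factor `conj c` turns that coefficient into `|c|² > 0`, so `Φ` is nonzero. -/
theorem exists_real_polynomial_of_ne_zero {τ : Type*} {g : MvPolynomial τ ℂ} (hg : g ≠ 0) :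
    ∃ Φ : MvPolynomial τ ℝ, Φ ≠ 0 ∧ ∀ x : τ → ℝ, MvPolynomial.eval x Φ ≠ 0 →
      MvPolynomial.eval (fun v => (x v : ℂ)) g ≠ 0 := by
  obtain ⟨d, hd⟩ := MvPolynomial.ne_zero_iff.mp hg
  refine ⟨∑ m ∈ g.support, MvPolynomial.monomial m (conj (g.coeff d) * g.coeff m).re, ?_, ?_⟩
  · refine MvPolynomial.ne_zero_iff.mpr ⟨d, ?_⟩
    classical
    rw [MvPolynomial.coeff_sum]
    simp only [MvPolynomial.coeff_monomial]
    rw [Finset.sum_ite_eq' g.support d, if_pos (MvPolynomial.mem_support_iff.mpr hd),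
      ← Complex.normSq_eq_conj_mul_self, Complex.ofReal_re]
    exact (Complex.normSq_pos.mpr hd).ne'
  · intro x hx h0
    apply hx
    have h : MvPolynomial.eval x
        (∑ m ∈ g.support, MvPolynomial.monomial m (conj (g.coeff d) * g.coeff m).re) =
        (conj (g.coeff d) * MvPolynomial.eval (fun v => (x v : ℂ)) g).re := by
      rw [MvPolynomial.eval_eq (X := fun v => (x v : ℂ)), Finset.mul_sum, Complex.re_sum, map_sum]
      refine Finset.sum_congr rfl fun m _ => ?_
      rw [MvPolynomial.eval_monomial, Finsupp.prod, ← mul_assoc]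
      have hp : (∏ i ∈ m.support, (x i : ℂ) ^ m i) = ((∏ i ∈ m.support, x i ^ m i : ℝ) : ℂ) := by
        push_cast
        rfl
      rw [hp, Complex.re_mul_ofReal]
    rw [h, h0, mul_zero, Complex.zero_re]

/-! ### Properties of generic pencils -/

/-- A property holds generically if it holds wherever some nonzero real polynomial in the real
coordinates does not vanish. -/
def Generic (P : Pencil k → Prop) : Prop :=
  ∃ Φ : MvPolynomial (Index k ⊕ Index k) ℝ, Φ ≠ 0 ∧
    ∀ a, MvPolynomial.eval (realCoords a) Φ ≠ 0 → P a

theorem Generic.mono {P R : Pencil k → Prop} (hP : Generic P) (h : ∀ a, P a → R a) :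
    Generic R := by
  obtain ⟨Φ, h0, hΦ⟩ := hP
  exact ⟨Φ, h0, fun a ha => h a (hΦ a ha)⟩

theorem Generic.forall {ι : Type*} [Finite ι] {P : ι → Pencil k → Prop}
    (h : ∀ i, Generic (P i)) : Generic fun a => ∀ i, P i a := by
  have := Fintype.ofFinite ι
  choose Φ h0 hΦ using h
  refine ⟨∏ i, Φ i, Finset.prod_ne_zero_iff.mpr fun i _ => h0 i, fun a ha i => hΦ i a ?_⟩
  rw [map_prod] at ha
  exact Finset.prod_ne_zero_iff.mp ha i (Finset.mem_univ i)

theorem Generic.and {P R : Pencil k → Prop} (hP : Generic P) (hR : Generic R) :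
    Generic fun a => P a ∧ R a := by
  obtain ⟨Φ, h0, hΦ⟩ := hP
  obtain ⟨Ψ, h1, hΨ⟩ := hR
  refine ⟨Φ * Ψ, mul_ne_zero h0 h1, fun a ha => ?_⟩
  rw [map_mul] at ha
  exact ⟨hΦ a (left_ne_zero_of_mul ha), hΨ a (right_ne_zero_of_mul ha)⟩

theorem generic_of_imp {c : Prop} {P : Pencil k → Prop} (h : c → Generic P) :
    Generic fun a => c → P a := by
  by_cases hc : c
  · exact (h hc).mono fun a ha _ => ha
  · exact ⟨1, one_ne_zero, fun a _ h => absurd h hc⟩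

theorem generic_apply_ne_zero (v : Index k) : Generic fun a : Pencil k => a v ≠ 0 := by
  refine ⟨MvPolynomial.X (Sum.inl v), MvPolynomial.X_ne_zero _, fun a ha h => ha ?_⟩
  simp [realCoords, h]

/-- Dimension count: a polynomial map `f` from the coefficient space to itself has generically
a fibre on which a given polynomial function takes only finitely many values. -/
theorem generic_finite_image {f : Pencil k → Pencil k} {h : Pencil k → ℂ}
    (hf : ∀ v, (fun θ => f θ v) ∈ polyFun k) (hh : h ∈ polyFun k) :
    Generic fun a => (h '' (f ⁻¹' {a})).Finite := by
  obtain ⟨G, hG0, hG⟩ := exists_polynomial_relation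
    (F := fun o => o.elim h fun v θ => ((realCoords (f θ) v : ℝ) : ℂ))
    (fun o => by
      cases o with
      | none => exact hh
      | some v => exact realCoords_comp_mem_polyFun hf v)
  have hG1 : MvPolynomial.optionEquivLeft ℂ (Index k ⊕ Index k) G ≠ 0 := by simpa using hG0
  -- `G` is read as a polynomial in the variable `none`, the slot of `h`. Its nonzero coefficient at
  -- `m` gives the genericity condition on `a`.
  obtain ⟨m, hm⟩ : ∃ m, (MvPolynomial.optionEquivLeft ℂ (Index k ⊕ Index k) G).coeff m ≠ 0 := by
    by_contra! hc
    exact hG1 (Polynomial.ext fun n => by simpa using hc n)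
  obtain ⟨Φ, hΦ0, hΦ⟩ := exists_real_polynomial_of_ne_zero hm
  refine ⟨Φ, hΦ0, fun a ha => ?_⟩
  set R : ℂ[X] := (MvPolynomial.optionEquivLeft ℂ (Index k ⊕ Index k) G).map
    (MvPolynomial.eval fun v => ((realCoords a v : ℝ) : ℂ)) with hR
  have hR0 : R ≠ 0 := by
    intro h0
    apply hΦ _ ha
    have := congrArg (fun q => q.coeff m) h0
    simpa [hR, Polynomial.coeff_map] using this
  refine (Polynomial.finite_setOfPred_isRoot hR0).subset ?_
  rintro _ ⟨θ, hθ, rfl⟩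
  have hθ' : f θ = a := hθ
  have h1 := hG θ
  have h2 : (fun o : Option (Index k ⊕ Index k) =>
      o.elim h (fun v θ => ((realCoords (f θ) v : ℝ) : ℂ)) θ) =
      fun o => o.elim (h θ) fun v => ((realCoords a v : ℝ) : ℂ) := by
    ext o
    cases o <;> simp [hθ']
  rwa [h2, MvPolynomial.optionEquivLeft_elim_eval] at h1

/-! ### Polynomials with prescribed roots -/

/-- The polynomial `c * ∏ l, (X - w l)`. -/
noncomputable def splitPoly (c : ℂ) (w : Fin k → ℂ) : ℂ[X] :=
  C c * ∏ l, (X - C (w l))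

theorem coeff_mul_mem_polyFun {F G : Pencil k → ℂ[X]}
    (hF : ∀ n, (fun θ => (F θ).coeff n) ∈ polyFun k)
    (hG : ∀ n, (fun θ => (G θ).coeff n) ∈ polyFun k) (n : ℕ) :
    (fun θ => (F θ * G θ).coeff n) ∈ polyFun k := by
  convert (polyFun k).sum_mem (t := Finset.HasAntidiagonal.antidiagonal n)
    (fun x _ => (polyFun k).mul_mem (hF x.1) (hG x.2)) using 1
  ext θ
  simp [Polynomial.coeff_mul]

theorem coeff_C_mem_polyFun {f : Pencil k → ℂ} (hf : f ∈ polyFun k) (n : ℕ) :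
    (fun θ => (C (f θ)).coeff n) ∈ polyFun k := by
  simp only [Polynomial.coeff_C]
  split_ifs
  · exact hf
  · exact const_mem_polyFun 0

theorem coeff_splitPoly_mem_polyFun {c : Pencil k → ℂ} {w : Pencil k → Fin k → ℂ}
    (hc : c ∈ polyFun k) (hw : ∀ l, (fun θ => w θ l) ∈ polyFun k) (n : ℕ) :
    (fun θ => (splitPoly (c θ) (w θ)).coeff n) ∈ polyFun k := by
  refine coeff_mul_mem_polyFun (coeff_C_mem_polyFun hc) ?_ n
  generalize (Finset.univ : Finset (Fin k)) = s
  induction s using Finset.induction_on with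
  | empty =>
    intro n
    simpa using coeff_C_mem_polyFun (const_mem_polyFun (k := k) 1) n
  | insert l s hl ih =>
    simp only [Finset.prod_insert hl]
    refine coeff_mul_mem_polyFun (fun n => ?_) ih
    simp only [Polynomial.coeff_sub]
    exact (polyFun k).sub_mem (const_mem_polyFun _) (coeff_C_mem_polyFun (hw l) n)

theorem exists_eq_splitPoly {P : ℂ[X]} (hP : P.natDegree = k) :
    ∃ w : Fin k → ℂ, P = splitPoly P.leadingCoeff w := by
  have hs := IsAlgClosed.splits P
  have hcard : P.roots.toList.length = k := by
    rw [Multiset.length_toList, ← hs.natDegree_eq_card_roots, hP]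
  subst hcard
  refine ⟨fun l => P.roots.toList[l], ?_⟩
  conv_lhs => rw [hs.eq_prod_roots]
  rw [splitPoly]
  congr 1
  conv_lhs => rw [← Multiset.coe_toList P.roots, Multiset.map_coe, Multiset.prod_coe]
  rw [← List.prod_ofFn]
  congr 1
  apply List.ext_getElem <;> simp

theorem roots_splitPoly {c : ℂ} (hc : c ≠ 0) (w : Fin k → ℂ) :
    (splitPoly c w).roots = Finset.univ.val.map w := by
  rw [splitPoly, Polynomial.roots_C_mul _ hc]
  have h := Polynomial.roots_multiset_prod_X_sub_C (Finset.univ.val.map w)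
  rwa [Multiset.map_map] at h

theorem mem_roots_splitPoly {c : ℂ} (hc : c ≠ 0) {w : Fin k → ℂ} {z : ℂ} :
    z ∈ (splitPoly c w).roots ↔ ∃ l, w l = z := by
  simp [roots_splitPoly hc]

theorem exists_eq_of_not_nodup_roots_splitPoly {c : ℂ} (hc : c ≠ 0) {w : Fin k → ℂ}
    (h : ¬ (splitPoly c w).roots.Nodup) : ∃ l m, l ≠ m ∧ w l = w m := by
  by_contra! hw
  apply h
  rw [roots_splitPoly hc]
  exact Finset.univ.nodup.map fun l m hlm => by_contra fun hne => hw l m hne hlm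

/-! ### Characteristic polynomial -/

theorem coeff_characteristic (a : Pencil k) (i : Fin (k + 1)) :
    (characteristic a).coeff (k - i) = diag a i := by
  rw [characteristic, Polynomial.finsetSum_coeff, Finset.sum_eq_single i]
  · simp
  · intro j _ hj
    rw [Polynomial.coeff_C_mul_X_pow, if_neg]
    intro h
    exact hj (Fin.ext (by omega))
  · simp

theorem natDegree_characteristic {a : Pencil k} (ha : diag a 0 ≠ 0) :
    (characteristic a).natDegree = k := by
  refine Polynomial.natDegree_eq_of_le_of_coeff_ne_zero ?_ ?_
  · refine Polynomial.natDegree_sum_le_of_forall_le _ _ fun i _ => ?_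
    exact (Polynomial.natDegree_C_mul_X_pow_le _ _).trans (Nat.sub_le _ _)
  · have := coeff_characteristic a 0
    simp only [Fin.val_zero, Nat.sub_zero] at this
    rwa [this]

/-- The pencil with the off-diagonal coefficients of `θ` and with characteristic polynomial
`c * ∏ l, (t - s l)`. -/
noncomputable def ofCharacteristic (θ : Pencil k) (c : ℂ) (s : Fin k → ℂ) : Pencil k :=
  fun v => if v.2 = Fin.last v.1.1 then (splitPoly c s).coeff (k - v.1) else θ v

theorem ofCharacteristic_mem_polyFun {c : Pencil k → ℂ} {s : Pencil k → Fin k → ℂ}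
    (hc : c ∈ polyFun k) (hs : ∀ l, (fun θ => s θ l) ∈ polyFun k) (v : Index k) :
    (fun θ => ofCharacteristic θ (c θ) (s θ) v) ∈ polyFun k := by
  simp only [ofCharacteristic]
  split_ifs
  · exact coeff_splitPoly_mem_polyFun hc hs _
  · exact apply_mem_polyFun v

theorem ofCharacteristic_eq {a θ : Pencil k} {c : ℂ} {s : Fin k → ℂ}
    (ha : characteristic a = splitPoly c s)
    (hθ : ∀ v : Index k, v.2 ≠ Fin.last v.1.1 → θ v = a v) : ofCharacteristic θ c s = a := by
  ext ⟨i, j⟩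
  by_cases hj : j = Fin.last i.1
  · subst hj
    simp only [ofCharacteristic, if_true, ← ha]
    exact coeff_characteristic a i
  · simp only [ofCharacteristic, if_neg hj]
    exact hθ ⟨i, j⟩ hj

/-- Replaces the diagonal coefficients of a pencil. -/
def setDiag (a : Pencil k) (d : Fin (k + 1) → ℂ) : Pencil k :=
  fun v => if v.2 = Fin.last v.1.1 then d v.1 else a v

theorem diag_setDiag (a : Pencil k) (d : Fin (k + 1) → ℂ) : diag (setDiag a d) = d := by
  ext i
  simp [diag, setDiag]

/-- Root `m` is given by a real multiplier of root `l`, stored in the real part of slot `m`. The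
imaginary part does not affect the pencil, so it is unbounded on any nonempty fibre. -/
theorem generic_no_real_root_ratio (l m : Fin k) (hlm : l ≠ m) :
    Generic fun a : Pencil k => ¬ ∃ (c : ℂ) (s : Fin k → ℂ) (r : ℝ),
      characteristic a = splitPoly c s ∧ s m = r * s l := by
  let s (θ : Pencil k) (i : Fin k) : ℂ :=
    if i = m then ((diag θ m.succ).re : ℂ) * diag θ l.succ else diag θ i.succ
  have hs : ∀ i, (fun θ => s θ i) ∈ polyFun k := by
    intro i
    simp only [s]
    split_ifs
    · exact (polyFun k).mul_mem (re_apply_mem_polyFun _) (apply_mem_polyFun _)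
    · exact apply_mem_polyFun _
  refine (generic_finite_image (f := fun θ => ofCharacteristic θ (diag θ 0) (s θ))
    (h := fun θ => ((diag θ m.succ).im : ℂ))
    (ofCharacteristic_mem_polyFun (apply_mem_polyFun _) hs) (im_apply_mem_polyFun _)).mono ?_
  rintro a hfin ⟨c, t, r, ha, hr⟩
  refine (Set.infinite_range_of_injective Complex.ofReal_injective) (hfin.subset ?_)
  rintro _ ⟨y, rfl⟩
  let d : Fin (k + 1) → ℂ := Fin.cons c fun i => if i = m then ⟨r, y⟩ else t i
  refine ⟨setDiag a d, ?_, ?_⟩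
  · change ofCharacteristic _ _ _ = a
    have ht : s (setDiag a d) = t := by
      ext i
      by_cases hi : i = m
      · subst hi
        simp [s, diag_setDiag, d, hlm, hr]
      · simp [s, diag_setDiag, d, hi]
    rw [ht]
    refine ofCharacteristic_eq ?_ fun v hv => by simp [setDiag, hv]
    simpa [diag_setDiag, d] using ha
  · simp [diag_setDiag, d]

theorem exists_real_ratio {s t : ℂ} (hs : s ≠ 0) (h : Collinear ℝ ({0, s, t} : Set ℂ)) :
    ∃ r : ℝ, t = r * s := by
  rw [collinear_iff_of_mem (p₀ := (0 : ℂ)) (by simp)] at h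
  obtain ⟨v, hv⟩ := h
  obtain ⟨x, hx⟩ := hv s (by simp)
  obtain ⟨y, hy⟩ := hv t (by simp)
  simp only [vadd_eq_add, add_zero, Complex.real_smul] at hx hy
  have hx0 : (x : ℂ) ≠ 0 := fun h => hs (by rw [hx, h, zero_mul])
  refine ⟨y / x, ?_⟩
  rw [hy, hx]
  push_cast
  field_simp

theorem generic_isGeneralType : Generic fun a : Pencil k => IsGeneralType a := by
  have h1 := generic_apply_ne_zero (k := k) ⟨Fin.last k, Fin.last k⟩
  have h2 := generic_apply_ne_zero (k := k) ⟨0, Fin.last 0⟩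
  have h3 := Generic.forall fun l : Fin k => Generic.forall fun m : Fin k =>
    generic_of_imp fun hlm : l ≠ m => generic_no_real_root_ratio l m hlm
  refine ((h1.and h2).and h3).mono ?_
  rintro a ⟨⟨ha1, ha2⟩, ha3⟩
  have hd0 : diag a 0 ≠ 0 := ha2
  have hdk : diag a (Fin.last k) ≠ 0 := ha1
  obtain ⟨s, hs⟩ := exists_eq_splitPoly (natDegree_characteristic hd0)
  have hlc : (characteristic a).leadingCoeff ≠ 0 := by
    rw [Polynomial.leadingCoeff, natDegree_characteristic hd0]
    have := coeff_characteristic a 0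
    simp only [Fin.val_zero, Nat.sub_zero] at this
    rwa [this]
  refine ⟨hdk, hd0, ?_, ?_⟩
  · by_contra hn
    rw [hs] at hn
    obtain ⟨l, m, hlm, h⟩ := exists_eq_of_not_nodup_roots_splitPoly hlc hn
    -- A double root is the case of ratio 1.
    exact ha3 l m hlm ⟨_, s, 1, hs, by simp [h]⟩
  · intro x hx y hy hxy hcol
    have hx0 : x ≠ 0 := by
      rintro rfl
      have h0 := (Polynomial.mem_roots'.mp hx).2
      rw [Polynomial.IsRoot, ← Polynomial.coeff_zero_eq_eval_zero] at h0
      have := coeff_characteristic a (Fin.last k)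
      simp only [Fin.val_last, Nat.sub_self] at this
      exact hdk (this ▸ h0)
    obtain ⟨r, hr⟩ := exists_real_ratio hx0 hcol
    rw [hs] at hx hy
    obtain ⟨l, rfl⟩ := (mem_roots_splitPoly hlc).mp hx
    obtain ⟨m, rfl⟩ := (mem_roots_splitPoly hlc).mp hy
    exact ha3 l m (fun h => hxy (h ▸ rfl)) ⟨_, s, r, hs, hr⟩

/-! ### Fibres of the plane curve -/

theorem eval_Q (a : Pencil k) (i : Fin (k + 1)) (p : ℂ) :
    (Q a i).eval p = ∑ j : Fin (i.1 + 1), a ⟨i, j⟩ * p ^ j.1 := by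
  simp [Q, Polynomial.eval_finsetSum]

theorem Q_ne_zero {a : Pencil k} {i : Fin (k + 1)} (h : diag a i ≠ 0) : Q a i ≠ 0 := by
  intro h0
  apply h
  have hc : (Q a i).coeff i = diag a i := by
    rw [Q, Polynomial.finsetSum_coeff, Finset.sum_eq_single (Fin.last i.1)]
    · simp [diag]
    · intro j _ hj
      rw [Polynomial.coeff_C_mul_X_pow, if_neg]
      intro hk
      exact hj (Fin.ext hk.symm)
    · simp
  rw [← hc, h0, Polynomial.coeff_zero]

theorem coeff_fibre (a : Pencil k) (p : ℂ) (i : Fin (k + 1)) :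
    (fibre a p).coeff i = (Q a i).eval p := by
  rw [fibre, Polynomial.finsetSum_coeff, Finset.sum_eq_single i]
  · rw [Polynomial.coeff_C_mul_X_pow, if_pos rfl]
  · intro j _ hj
    rw [Polynomial.coeff_C_mul_X_pow, if_neg]
    intro h
    exact hj (Fin.ext h.symm)
  · simp

theorem leadingCoeff_fibre {a : Pencil k} {p : ℂ} (hp : (Q a (Fin.last k)).eval p ≠ 0) :
    (fibre a p).natDegree = k ∧ (fibre a p).leadingCoeff ≠ 0 := by
  have hc : (fibre a p).coeff k ≠ 0 := by
    have := coeff_fibre a p (Fin.last k)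
    rw [Fin.val_last] at this
    rwa [this]
  have hd : (fibre a p).natDegree = k := by
    refine Polynomial.natDegree_eq_of_le_of_coeff_ne_zero ?_ hc
    refine Polynomial.natDegree_sum_le_of_forall_le _ _ fun i _ => ?_
    exact (Polynomial.natDegree_C_mul_X_pow_le _ _).trans (Nat.lt_succ_iff.mp i.2)
  exact ⟨hd, by rwa [Polynomial.leadingCoeff, hd]⟩

/-- The pencil with the coefficients `a i j`, `j ≠ 0`, of `θ` and with fibre
`c * ∏ l, (X - w l)` at `p`. -/
noncomputable def ofFibre (θ : Pencil k) (p c : ℂ) (w : Fin k → ℂ) : Pencil k :=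
  fun v => if v.2 = 0 then
    (splitPoly c w).coeff v.1 - ∑ j : Fin v.1.1, θ ⟨v.1, j.succ⟩ * p ^ (j.1 + 1) else θ v

theorem ofFibre_mem_polyFun {p c : Pencil k → ℂ} {w : Pencil k → Fin k → ℂ}
    (hp : p ∈ polyFun k) (hc : c ∈ polyFun k) (hw : ∀ l, (fun θ => w θ l) ∈ polyFun k)
    (v : Index k) : (fun θ => ofFibre θ (p θ) (c θ) (w θ) v) ∈ polyFun k := by
  simp only [ofFibre]
  split_ifs
  · refine (polyFun k).sub_mem (coeff_splitPoly_mem_polyFun hc hw _) ?_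
    convert (polyFun k).sum_mem (t := Finset.univ) (fun (j : Fin v.1.1) _ =>
      (polyFun k).mul_mem (apply_mem_polyFun ⟨v.1, j.succ⟩)
        ((polyFun k).pow_mem hp (j.1 + 1))) using 1
    ext θ
    simp
  · exact apply_mem_polyFun v

theorem ofFibre_eq {a θ : Pencil k} {p c : ℂ} {w : Fin k → ℂ}
    (ha : fibre a p = splitPoly c w) (hθ : ∀ v : Index k, v.2 ≠ 0 → θ v = a v) :
    ofFibre θ p c w = a := by
  ext ⟨i, j⟩
  by_cases hj : j = 0
  · subst hj
    simp only [ofFibre, if_true, ← ha, coeff_fibre, eval_Q, Fin.sum_univ_succ, Fin.val_zero, pow_zero,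
      mul_one, Fin.val_succ]
    rw [Finset.sum_congr rfl fun (j : Fin i.1) _ =>
      congrArg (· * p ^ (j.1 + 1)) (hθ ⟨i, j.succ⟩ (Fin.succ_ne_zero j)), add_sub_cancel_right]
  · simp only [ofFibre, if_neg hj]
    exact hθ ⟨i, j⟩ hj

/-- The coefficients `a i 0` of a pencil. -/
def bottom (a : Pencil k) (i : Fin (k + 1)) : ℂ := a ⟨i, 0⟩

/-- Replaces the coefficients `a i 0` of a pencil. -/
def setBottom (a : Pencil k) (d : Fin (k + 1) → ℂ) : Pencil k :=
  fun v => if v.2 = 0 then d v.1 else a v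

theorem bottom_setBottom (a : Pencil k) (d : Fin (k + 1) → ℂ) : bottom (setBottom a d) = d := by
  ext i
  simp [bottom, setBottom]

/-- If the roots of the fibre at `p`, together with `p`, depend polynomially on `k` complex
parameters, then generically only finitely many `p` occur. -/
theorem generic_finite_of_parametrization {p : Pencil k → ℂ} {w : Pencil k → Fin k → ℂ}
    (hp : p ∈ polyFun k) (hw : ∀ l, (fun θ => w θ l) ∈ polyFun k)
    {R : ℂ → (Fin k → ℂ) → Prop}
    (hR : ∀ q u, R q u → ∃ d : Fin k → ℂ, ∀ θ : Pencil k, (∀ l, bottom θ l.succ = d l) →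
      p θ = q ∧ w θ = u) :
    Generic fun a : Pencil k => {q | ∃ c u, fibre a q = splitPoly c u ∧ R q u}.Finite := by
  refine (generic_finite_image (f := fun θ => ofFibre θ (p θ) (bottom θ 0) (w θ)) (h := p)
    (ofFibre_mem_polyFun hp (apply_mem_polyFun _) hw) hp).mono fun a hfin => hfin.subset ?_
  rintro q ⟨c, u, ha, hq⟩
  -- The `k + 1` bottom coefficients are overwritten: slot 0 carries the leading coefficient `c`,
  -- the others the parameters `d`.
  obtain ⟨d, hd⟩ := hR q u hq
  obtain ⟨h1, h2⟩ := hd (setBottom a (Fin.cons c d)) fun l => by simp [bottom_setBottom]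
  refine ⟨setBottom a (Fin.cons c d), ?_, h1⟩
  change ofFibre _ _ _ _ = a
  rw [h1, h2]
  refine ofFibre_eq ?_ fun v hv => by simp [setBottom, hv]
  simpa [bottom_setBottom] using ha

/-- Root `m` copies root `l`, so slot `m` is free to hold the point `q`. -/
theorem generic_finite_coincidence (l m : Fin k) (hlm : l ≠ m) :
    Generic fun a : Pencil k => {q | ∃ c u, fibre a q = splitPoly c u ∧ u l = u m}.Finite := by
  refine generic_finite_of_parametrization (p := fun θ => bottom θ m.succ)
    (w := fun θ i => if i = m then bottom θ l.succ else bottom θ i.succ)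
    (R := fun _ u => u l = u m) (apply_mem_polyFun _) (fun i => ?_) fun q u hu => ?_
  · split_ifs <;> exact apply_mem_polyFun _
  · refine ⟨fun i => if i = m then q else u i, fun θ hθ => ⟨by simp [hθ], ?_⟩⟩
    ext i
    by_cases hi : i = m
    · subst hi
      simp [hθ, hlm, hu]
    · simp [hθ, hi]

/-- The constraints are solved one after the other: `s₂` from `s₀, s₁`, then `t₂` from `t₀, t₁`.
Since `t₂` lies outside the first triple, the second step does not disturb the first, while `t₀` or
`t₁` may equal `s₂`. -/
theorem generic_finite_two_collinear {s₀ s₁ s₂ t₀ t₁ t₂ : Fin k}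
    (h : (s₀ ≠ s₂ ∧ s₁ ≠ s₂) ∧ (s₀ ≠ t₂ ∧ s₁ ≠ t₂ ∧ s₂ ≠ t₂) ∧ t₀ ≠ t₂ ∧ t₁ ≠ t₂) :
    Generic fun a : Pencil k => {q | ∃ c u, fibre a q = splitPoly c u ∧
      (∃ r : ℝ, u s₂ = u s₀ + r * (u s₁ - u s₀)) ∧
      ∃ r : ℝ, u t₂ = u t₀ + r * (u t₁ - u t₀)}.Finite := by
  obtain ⟨⟨h02, h12⟩, ⟨h0, h1, h2⟩, ht0, ht1⟩ := h
  let b (i : Fin k) (θ : Pencil k) : ℂ := bottom θ i.succ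
  let x (i : Fin k) (θ : Pencil k) : ℂ :=
    if i = s₂ then b s₀ θ + ((b s₂ θ).re : ℂ) * (b s₁ θ - b s₀ θ) else b i θ
  have hb : ∀ i, b i ∈ polyFun k := fun i => apply_mem_polyFun _
  have hx : ∀ i, x i ∈ polyFun k := by
    intro i
    by_cases hi : i = s₂
    · have : x i = fun θ => b s₀ θ + ((b s₂ θ).re : ℂ) * (b s₁ θ - b s₀ θ) := by
        ext θ
        simp [x, hi]
      rw [this]
      exact (polyFun k).add_mem (hb _)
        ((polyFun k).mul_mem (re_apply_mem_polyFun _) ((polyFun k).sub_mem (hb _) (hb _)))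
    · have : x i = b i := by
        ext θ
        simp [x, hi]
      rw [this]
      exact hb i
  refine generic_finite_of_parametrization
    (p := fun θ => ((b s₂ θ).im : ℂ) + ((b t₂ θ).im : ℂ) * Complex.I)
    (w := fun θ i => if i = t₂ then x t₀ θ + ((b t₂ θ).re : ℂ) * (x t₁ θ - x t₀ θ) else x i θ)
    (R := fun _ u => (∃ r : ℝ, u s₂ = u s₀ + r * (u s₁ - u s₀)) ∧
      ∃ r : ℝ, u t₂ = u t₀ + r * (u t₁ - u t₀)) ?_ (fun i => ?_) ?_
  · exact (polyFun k).add_mem (im_apply_mem_polyFun _)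
      ((polyFun k).mul_mem (im_apply_mem_polyFun _) (const_mem_polyFun _))
  · split_ifs
    · exact (polyFun k).add_mem (hx _)
        ((polyFun k).mul_mem (re_apply_mem_polyFun _) ((polyFun k).sub_mem (hx _) (hx _)))
    · exact hx i
  · rintro q u ⟨⟨r, hr⟩, r', hr'⟩
    -- The real parts of slots `s₂` and `t₂` hold the multipliers `r` and `r'`, their imaginary
    -- parts the two real coordinates of `q`.
    refine ⟨fun i => if i = s₂ then ⟨r, q.re⟩ else if i = t₂ then ⟨r', q.im⟩ else u i,
      fun θ hθ => ?_⟩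
    have hb' : ∀ i, b i θ =
        if i = s₂ then ⟨r, q.re⟩ else if i = t₂ then ⟨r', q.im⟩ else u i := hθ
    have hxu : ∀ i, i ≠ t₂ → x i θ = u i := by
      intro i hi
      by_cases his : i = s₂
      · subst his
        simp [x, hb', h02, h12, h0, h1, hr]
      · simp [x, hb', his, hi]
    refine ⟨?_, ?_⟩
    · simp [hb', h2.symm, Complex.re_add_im]
    · ext i
      by_cases hi : i = t₂
      · subst hi
        simp [hxu, ht0, ht1, hb', h2.symm, hr']
      · simp [hi, hxu]

theorem exists_real_combination {x y z : ℂ} (hxy : x ≠ y) {S : Set ℂ} (h : Collinear ℝ S)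
    (hx : x ∈ S) (hy : y ∈ S) (hz : z ∈ S) : ∃ r : ℝ, z = x + r * (y - x) := by
  obtain ⟨v, hv⟩ := (collinear_iff_of_mem hx).mp h
  obtain ⟨α, hα⟩ := hv y hy
  obtain ⟨β, hβ⟩ := hv z hz
  simp only [vadd_eq_add, Complex.real_smul] at hα hβ
  have hα0 : (α : ℂ) ≠ 0 := fun h => hxy (by rw [hα, h, zero_mul, zero_add])
  refine ⟨β / α, ?_⟩
  rw [hβ, hα]
  push_cast
  field_simp
  ring

/-- Choosing `y₂` in `T` but not in `S` yields the ordering needed to solve the two constraints in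
turn. The triples may otherwise overlap. -/
theorem exists_triples {S T : Finset ℂ} (hST : S ≠ T) (hS : S.card = 3) (hT : T.card = 3) :
    ∃ x₀ x₁ x₂ y₀ y₁ y₂ : ℂ, S = {x₀, x₁, x₂} ∧ T = {y₀, y₁, y₂} ∧ x₀ ≠ x₁ ∧ y₀ ≠ y₁ ∧
      (x₀ ≠ x₂ ∧ x₁ ≠ x₂) ∧ (x₀ ≠ y₂ ∧ x₁ ≠ y₂ ∧ x₂ ≠ y₂) ∧ y₀ ≠ y₂ ∧ y₁ ≠ y₂ := by
  obtain ⟨y₂, hyT, hyS⟩ : ∃ y ∈ T, y ∉ S := by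
    by_contra! hsub
    exact hST (Finset.eq_of_subset_of_card_le hsub (by omega)).symm
  obtain ⟨x₀, x₁, x₂, h01, h02, h12, rfl⟩ := Finset.card_eq_three.mp hS
  have hcard : (T.erase y₂).card = 2 := by rw [Finset.card_erase_of_mem hyT, hT]
  obtain ⟨y₀, y₁, hy, hE⟩ := Finset.card_eq_two.mp hcard
  have hy0 : y₀ ∈ T.erase y₂ := by simp [hE]
  have hy1 : y₁ ∈ T.erase y₂ := by simp [hE]
  simp only [Finset.mem_insert, Finset.mem_singleton, not_or] at hyS
  refine ⟨x₀, x₁, x₂, y₀, y₁, y₂, rfl, ?_, h01, hy, ⟨h02, h12⟩,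
    ⟨Ne.symm hyS.1, Ne.symm hyS.2.1, Ne.symm hyS.2.2⟩, Finset.ne_of_mem_erase hy0,
    Finset.ne_of_mem_erase hy1⟩
  rw [← Finset.insert_erase hyT, hE]
  ext z
  simp only [Finset.mem_insert, Finset.mem_singleton]
  tauto

theorem generic_finite_Gamma2 : Generic fun a : Pencil k => (Gamma2 a).Finite := by
  have h1 := generic_apply_ne_zero (k := k) ⟨Fin.last k, Fin.last k⟩
  have h2 := Generic.forall fun l : Fin k => Generic.forall fun m : Fin k =>
    generic_of_imp fun hlm : l ≠ m => generic_finite_coincidence l m hlm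
  have h3 := Generic.forall fun s₀ : Fin k => Generic.forall fun s₁ : Fin k =>
    Generic.forall fun s₂ : Fin k => Generic.forall fun t₀ : Fin k =>
    Generic.forall fun t₁ : Fin k => Generic.forall fun t₂ : Fin k =>
    generic_of_imp (generic_finite_two_collinear (s₀ := s₀) (s₁ := s₁) (s₂ := s₂)
      (t₀ := t₀) (t₁ := t₁) (t₂ := t₂))
  refine ((h1.and h2).and h3).mono ?_
  rintro a ⟨⟨ha1, ha2⟩, ha3⟩
  have hQ : Q a (Fin.last k) ≠ 0 := Q_ne_zero ha1
  have hfin := ((Polynomial.finite_setOfPred_isRoot hQ).union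
    (Set.finite_iUnion fun l => Set.finite_iUnion fun m => Set.finite_iUnion (ha2 l m))).union
    (Set.finite_iUnion fun s₀ => Set.finite_iUnion fun s₁ => Set.finite_iUnion fun s₂ =>
      Set.finite_iUnion fun t₀ => Set.finite_iUnion fun t₁ => Set.finite_iUnion fun t₂ =>
      Set.finite_iUnion (ha3 s₀ s₁ s₂ t₀ t₁ t₂))
  refine hfin.subset fun p hp => ?_
  by_cases hp0 : (Q a (Fin.last k)).eval p = 0
  · exact Or.inl (Or.inl hp0)
  obtain ⟨hdeg, hlc⟩ := leadingCoeff_fibre hp0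
  obtain ⟨w, hw⟩ := exists_eq_splitPoly hdeg
  rcases hp with hp | hp | ⟨S, T, hST, hS, hT, hSr, hTr, hSc, hTc⟩
  · exact absurd hp hp0
  · rw [hw] at hp
    obtain ⟨l, m, hlm, h⟩ := exists_eq_of_not_nodup_roots_splitPoly hlc hp
    refine Or.inl (Or.inr ?_)
    simp only [Set.mem_iUnion]
    exact ⟨l, m, hlm, _, w, hw, h⟩
  · refine Or.inr ?_
    obtain ⟨x₀, x₁, x₂, y₀, y₁, y₂, rfl, rfl, hx, hy, ⟨h02, h12⟩, ⟨g0, g1, g2⟩, k02, k12⟩ :=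
      exists_triples hST hS hT
    have hroot : ∀ z ∈ (fibre a p).roots, ∃ l, w l = z := fun z hz =>
      (mem_roots_splitPoly hlc).mp (hw ▸ hz)
    obtain ⟨s₀, rfl⟩ := hroot x₀ (hSr _ (by simp))
    obtain ⟨s₁, rfl⟩ := hroot x₁ (hSr _ (by simp))
    obtain ⟨s₂, rfl⟩ := hroot x₂ (hSr _ (by simp))
    obtain ⟨t₀, rfl⟩ := hroot y₀ (hTr _ (by simp))
    obtain ⟨t₁, rfl⟩ := hroot y₁ (hTr _ (by simp))
    obtain ⟨t₂, rfl⟩ := hroot y₂ (hTr _ (by simp))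
    have hne : ∀ {i j}, w i ≠ w j → i ≠ j := fun h hij => h (hij ▸ rfl)
    simp only [Set.mem_iUnion]
    exact ⟨s₀, s₁, s₂, t₀, t₁, t₂,
      ⟨⟨hne h02, hne h12⟩, ⟨hne g0, hne g1, hne g2⟩, hne k02, hne k12⟩, _, w, hw,
      exists_real_combination hx hSc (by simp) (by simp) (by simp),
      exists_real_combination hy hTc (by simp) (by simp) (by simp)⟩

/-! ### Topology of the nonvanishing set of a real polynomial -/

theorem continuous_eval_realCoords (Φ : MvPolynomial (Index k ⊕ Index k) ℝ) :
    Continuous fun a : Pencil k => MvPolynomial.eval (realCoords a) Φ := by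
  refine (MvPolynomial.continuous_eval Φ).comp (continuous_pi fun v => ?_)
  rcases v with v | v
  · exact Complex.continuous_re.comp (continuous_apply v)
  · exact Complex.continuous_im.comp (continuous_apply v)

theorem realCoords_surjective : Function.Surjective (realCoords (k := k)) := fun x =>
  ⟨fun v => ⟨x (Sum.inl v), x (Sum.inr v)⟩, by ext v; rcases v with v | v <;> rfl⟩

theorem exists_eval_realCoords_ne_zero {Φ : MvPolynomial (Index k ⊕ Index k) ℝ} (h : Φ ≠ 0) :
    ∃ a, MvPolynomial.eval (realCoords a) Φ ≠ 0 := by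
  by_contra! hc
  refine h (MvPolynomial.funext fun x => ?_)
  obtain ⟨a, rfl⟩ := realCoords_surjective x
  rw [hc a, map_zero]

/-- On the real line from `a` to a point `b` with `Φ(b) ≠ 0`, `Φ` is a nonzero polynomial in one
variable, with finitely many zeros. Thus `a` is a limit of nonzeros. -/
theorem dense_eval_realCoords_ne_zero {Φ : MvPolynomial (Index k ⊕ Index k) ℝ} (h : Φ ≠ 0) :
    Dense {a | MvPolynomial.eval (realCoords a) Φ ≠ 0} := by
  intro a
  obtain ⟨b, hb⟩ := exists_eval_realCoords_ne_zero h
  let line (t : ℝ) : Pencil k := a + (t : ℂ) • (b - a)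
  let P : ℝ[X] := MvPolynomial.aeval
    (fun v => C (realCoords a v) + X * C (realCoords b v - realCoords a v)) Φ
  have hP : ∀ t, P.eval t = MvPolynomial.eval (realCoords (line t)) Φ := by
    intro t
    rw [← Polynomial.coe_aeval_eq_eval, ← MvPolynomial.coe_aeval_eq_eval]
    change (Polynomial.aeval t) (MvPolynomial.aeval _ Φ) = MvPolynomial.aeval _ Φ
    rw [← AlgHom.comp_apply]
    congr 1
    refine MvPolynomial.algHom_ext fun v => ?_
    rcases v with v | v <;> simp [realCoords, line]
  have hP0 : P ≠ 0 := by
    intro h0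
    apply hb
    have := hP 1
    rw [h0, Polynomial.eval_zero] at this
    simpa [line] using this.symm
  have hdense : Dense {t : ℝ | P.IsRoot t}ᶜ :=
    (Set.Finite.countable (Polynomial.finite_setOfPred_isRoot hP0)).dense_compl ℝ
  have hline : Continuous line := by fun_prop
  have h0 := map_mem_closure hline (hdense 0)
    (t := {a | MvPolynomial.eval (realCoords a) Φ ≠ 0}) fun t ht => by
      change MvPolynomial.eval _ _ ≠ 0
      rw [← hP t]
      exact ht
  simpa [line] using h0

end HomogenizedPencil

theorem mainTheorem7 (k : ℕ) :
    ∃ U : Set (HomogenizedPencil.Pencil k),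
      U.Nonempty ∧ U ⊆ HomogenizedPencil.generalType k ∧
      (∃ V : Set (HomogenizedPencil.Pencil k), HomogenizedPencil.IsZariskiOpen V ∧
        U = HomogenizedPencil.generalType k ∩ V) ∧
      IsOpen U ∧
      HomogenizedPencil.generalType k ⊆ closure U ∧
      (∀ Z : Set (HomogenizedPencil.Pencil k), HomogenizedPencil.IsZariskiClosed Z →
        U ⊆ Z → HomogenizedPencil.generalType k ⊆ Z) ∧
      ∀ a ∈ U, (HomogenizedPencil.Gamma2 a).Finite := by
  open HomogenizedPencil in
  obtain ⟨Φ, hΦ0, hΦ⟩ := (generic_isGeneralType (k := k)).and generic_finite_Gamma2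
  have hsub : {a | MvPolynomial.eval (realCoords a) Φ ≠ 0} ⊆ generalType k :=
    fun a ha => (hΦ a ha).1
  refine ⟨{a | MvPolynomial.eval (realCoords a) Φ ≠ 0}, exists_eval_realCoords_ne_zero hΦ0, hsub,
    ⟨_, ⟨{Φ}, ?_⟩, (Set.inter_eq_right.mpr hsub).symm⟩,
    isOpen_ne_fun (continuous_eval_realCoords Φ) continuous_const,
    fun a _ => dense_eval_realCoords_ne_zero hΦ0 a, ?_, fun a ha => (hΦ a ha).2⟩
  · ext a
    simp
  · rintro Z ⟨I, rfl⟩ hZ a _ F hF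
    -- Zariski density: `F` vanishes where `Φ` does not, so the product vanishes everywhere, and the
    -- polynomial ring is a domain.
    have h0 : F * Φ = 0 := by
      by_contra hne
      obtain ⟨b, hb⟩ := exists_eval_realCoords_ne_zero hne
      rw [map_mul] at hb
      exact left_ne_zero_of_mul hb (hZ (right_ne_zero_of_mul hb) F hF)
    rw [(mul_eq_zero.mp h0).resolve_right hΦ0, map_zero]
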